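/- Let $a<b$ be real numbers and let $f:(a,b)\times\mathbb R\to\mathbb R$ be any function. For $v\in BV(a,b)$ write $Dv=D^av\,dx+D^sv$ for the Lebesgue decomposition of the distributional derivative $Dv$ (a finite signed measure on $(a,b)$) with respect to Lebesgue measure, $\frac{D^sv}{|D^sv|}$ for the density of $D^sv$ with respect to its total variation, and $v(a^+)$, $v(b^-)$ for the one-sided traces. A function $u\in BV(a,b)$ is a bounded variation solution of $$-\left(\frac{u'}{\sqrt{1+(u')^2}}\right)'=f(x,u)\quad\text{in }(a,b) \tag{E}$$ if $f(\cdot,u(\cdot))\in L^1(a,b)$ and $$\int_a^b\frac{D^au\,D^a\phi}{\sqrt{1+(D^au)^2}}\,dx+\int_a^b\frac{D^su}{|D^su|}\,D^s\phi=\int_a^b f(x,u(x))\,\phi(x)\,dx$$ for all $\phi\in BV(a,b)$ such that $|D^s\phi|$ is absolutely continuous with respect to $|D^su|$ and $\phi(a^+)=\phi(b^-)=0$. **Theorem 3.3.** Let $u$ be a bounded variation solution of (E). (h) Suppose there is $c\in(a,b)$ such that $f(x,u(x))\ge0$ for a.e. $x\in(a,c)$ and $f(x,u(x))\le0$ for a.e.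 $x\in(c,b)$, and that either * there exist $\delta>0$ with $c-\delta\ge a$ and $\mu\in L^1(c-\delta,c)$ such that $f(x,u(x))\le\mu(x)$ for a.e. $x\in(c-\delta,c)$, $M(x):=\int_x^c\mu(t)\,dt>0$ for all $x\in[c-\delta,c)$, and $\int_{c-\delta}^c\frac{dx}{\sqrt{M(x)}}=+\infty$; or * there exist $\delta>0$ with $c+\delta\le b$ and $\nu\in L^1(c,c+\delta)$ such that $f(x,u(x))\ge\nu(x)$ for a.e. $x\in(c,c+\delta)$, $N(x):=\int_c^x\nu(t)\,dt<0$ for all $x\in(c,c+\delta]$, and $\int_c^{c+\delta}\frac{dx}{\sqrt{-N(x)}}=+\infty$. Then $u\in W^{2,1}_{\mathrm{loc}}(a,b)\cap W^{1,1}(a,b)$; in particular, $u$ agrees almost everywhere with a $C^1$ function on $(a,b)$, so that there is no jump and no derivative blow-up at $c$. (hh) Suppose there is $c\in(a,b)$ such that $f(x,u(x))\le0$ for a.e. $x\in(a,c)$ and $f(x,u(x))\ge0$ for a.e. $x\in(c,b)$, and that either * there exist $\delta>0$ with $c-\delta\ge a$ and $\nu\in L^1(c-\delta,c)$ such that $f(x,u(x))\ge\nu(x)$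 for a.e. $x\in(c-\delta,c)$, $N(x):=\int_x^c\nu(t)\,dt<0$ for all $x\in[c-\delta,c)$, and $\int_{c-\delta}^c\frac{dx}{\sqrt{-N(x)}}=+\infty$; or * there exist $\delta>0$ with $c+\delta\le b$ and $\mu\in L^1(c,c+\delta)$ such that $f(x,u(x))\le\mu(x)$ for a.e. $x\in(c,c+\delta)$, $M(x):=\int_c^x\mu(t)\,dt>0$ for all $x\in(c,c+\delta]$, and $\int_c^{c+\delta}\frac{dx}{\sqrt{M(x)}}=+\infty$. Then, again, $u\in W^{2,1}_{\mathrm{loc}}(a,b)\cap W^{1,1}(a,b)$; in particular, $u$ agrees almost everywhere with a $C^1$ function on $(a,b)$. -/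

import Mathlib

open Set Filter Topology MeasureTheory
open scoped ContDiff

noncomputable section

namespace PrescribedCurvature

/-- Test functions on `(a, b)`: smooth functions with compact support contained in `(a, b)`. -/
def IsTest (a b : ℝ) (η : ℝ → ℝ) : Prop :=
  ContDiff ℝ ∞ η ∧ HasCompactSupport η ∧ tsupport η ⊆ Ioo a b

/-- `v ∈ BV(a, b)` with distributional derivative `Dv = D`: `v ∈ L¹(a, b)`, and `D` is a (finite)
signed Borel measure on `(a, b)` (regarded as a signed measure on `ℝ` that is concentrated on
`(a, b)`) such that `∫ v η' dx = - ∫ η dD` for all test functions `η`.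
The measure `D` is uniquely determined by `v`. -/
structure HasBVDeriv (a b : ℝ) (v : ℝ → ℝ) (D : SignedMeasure ℝ) : Prop where
  integrableOn : IntegrableOn v (Ioo a b)
  concentrated : D.restrict (Ioo a b) = D
  byParts : ∀ η : ℝ → ℝ, IsTest a b η →
    ∫ x in Ioo a b, v x * deriv η x = - ∫ᵛ x, η x ∂•D

/-- The density `Dᵃv` of the absolutely continuous part of `Dv = D` with respect to the Lebesgue
measure. -/
def acDensity (D : SignedMeasure ℝ) : ℝ → ℝ := D.rnDeriv volume

/-- The singular part `Dˢv` of `Dv = D` with respect to the Lebesgue measure. -/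
def sing (D : SignedMeasure ℝ) : SignedMeasure ℝ := D.singularPart volume

/-- The density `Dˢv / |Dˢv|` of the singular part of `Dv = D` with respect to its own absolute
variation. -/
def singDir (D : SignedMeasure ℝ) : ℝ → ℝ := (sing D).rnDeriv (sing D).totalVariation

/-- The right trace `v(x₀⁺)` equals `l` (essential one-sided limit, so that it does not depend on
the representative of `v`). -/
def HasRightTrace (v : ℝ → ℝ) (x₀ l : ℝ) : Prop := Tendsto v (𝓝[>] x₀ ⊓ ae volume) (𝓝 l)

/-- The left trace `v(x₀⁻)` equals `l`. -/
def HasLeftTrace (v : ℝ → ℝ) (x₀ l : ℝ) : Prop := Tendsto v (𝓝[<] x₀ ⊓ ae volume) (𝓝 l)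

/-- `u` is a bounded variation solution of `-(u' / √(1 + u'²))' = f(x, u)` on `(a, b)`. Only the
values of `f` on `(a, b) × ℝ` matter. -/
def IsBVSolution (a b : ℝ) (f : ℝ → ℝ → ℝ) (u : ℝ → ℝ) : Prop :=
  ∃ Du : SignedMeasure ℝ, HasBVDeriv a b u Du ∧
    IntegrableOn (fun x => f x (u x)) (Ioo a b) ∧
    ∀ (φ : ℝ → ℝ) (Dφ : SignedMeasure ℝ), HasBVDeriv a b φ Dφ →
      (sing Dφ).totalVariation ≪ (sing Du).totalVariation →
      HasRightTrace φ a 0 → HasLeftTrace φ b 0 →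
      (∫ x in Ioo a b, acDensity Du x * acDensity Dφ x / √(1 + acDensity Du x ^ 2))
          + ∫ᵛ x, singDir Du x ∂•(sing Dφ)
        = ∫ x in Ioo a b, f x (u x) * φ x

/-- `g` is a weak derivative of `v` on `(a, b)`; both are locally integrable there. -/
structure HasWeakDeriv (a b : ℝ) (v g : ℝ → ℝ) : Prop where
  locallyIntegrableOn : LocallyIntegrableOn v (Ioo a b)
  locallyIntegrableOn_deriv : LocallyIntegrableOn g (Ioo a b)
  byParts : ∀ η : ℝ → ℝ, IsTest a b η →
    ∫ x in Ioo a b, v x * deriv η x = - ∫ x in Ioo a b, g x * η x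

/-- The Sobolev space `W^{1,1}(a, b)`. -/
def MemW11 (a b : ℝ) (v : ℝ → ℝ) : Prop :=
  IntegrableOn v (Ioo a b) ∧ ∃ v₁ : ℝ → ℝ, IntegrableOn v₁ (Ioo a b) ∧ HasWeakDeriv a b v v₁

/-- The local Sobolev space `W^{2,1}_loc(a, b)`. -/
def MemW21loc (a b : ℝ) (v : ℝ → ℝ) : Prop :=
  ∃ v₁ v₂ : ℝ → ℝ, HasWeakDeriv a b v v₁ ∧ HasWeakDeriv a b v₁ v₂

end PrescribedCurvature

end

/-! Write h(x) = f(x, u(x)) and P for its primitive. Every signed measure D on (a, b) of total mass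
zero is the derivative of a function with zero traces at both ends, so the equation can be tested
against measures (`FluxEquation`). Absolutely continuous D give, as in the du Bois-Reymond lemma,
that the flux D^a u / √(1 + (D^a u)²) equals W = m - P almost everywhere
(`FluxEquation.exists_flux_ae_eq`). Hence W is absolutely continuous with W' = -h, |W| < 1 a.e., and
D^a u = W / √(1 - W²) is integrable.

If |W| < 1 at every point of (a, b), a test measure with singular part D^s u gives ∫ W dD^s u = |D^s
u|(a, b), which forces D^s u = 0 (`FluxEquation.sing_eq_zero`). Then u' = W / √(1 - W²) is locally
absolutely continuous, which is the claimed regularity (`regularity_of_abs_lt_one`).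

It remains to exclude |W| = 1 (`abs_lt_one_of_sign_change`). In case (h), W decreases up to c and
increases afterwards, so only W(c) ≤ -1 is dangerous. In that case 1 + W ≤ M to the left of c, or 1
+ W ≤ -N to the right. There 1/√M, respectively 1/√(-N), is at most a constant plus a multiple of
the integrable |W| / √(1 - W²), against the assumed divergence. Case (hh) is case (h) for -W and -h.
-/

noncomputable section

namespace PrescribedCurvature

/-! ### Integrals against signed measures and Fubini for primitives -/

section

variable {X : Type*} [MeasurableSpace X]

theorem integral_toSignedMeasure_real (μ : Measure X) [IsFiniteMeasure μ] (f : X → ℝ) :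
    ∫ᵛ x, f x ∂•μ.toSignedMeasure = ∫ x, f x ∂μ := by
  rw [← VectorMeasure.integral_toSignedMeasure]
  congr 1
  ext
  simp

theorem integral_signedMeasure_eq {s : SignedMeasure X} {f : X → ℝ}
    (hf : Integrable f s.totalVariation) :
    ∫ᵛ x, f x ∂•s = ∫ x, f x ∂s.toJordanDecomposition.posPart
      - ∫ x, f x ∂s.toJordanDecomposition.negPart := by
  rw [SignedMeasure.totalVariation, integrable_add_measure] at hf
  conv_lhs => rw [← s.toSignedMeasure_toJordanDecomposition, JordanDecomposition.toSignedMeasure]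
  rw [VectorMeasure.integral_sub_vectorMeasure, integral_toSignedMeasure_real,
    integral_toSignedMeasure_real]
  · simpa [VectorMeasure.Integrable] using hf.1
  · simpa [VectorMeasure.Integrable] using hf.2

theorem integral_withDensityᵥ {μ : Measure X} {g f : X → ℝ} (hg : Integrable g μ)
    (hf : StronglyMeasurable f) {C : ℝ} (hC : ∀ x, |f x| ≤ C) :
    ∫ᵛ x, f x ∂•(μ.withDensityᵥ g) = ∫ x, f x * g x ∂μ := by
  wlog hgm : Measurable g generalizing g
  · have := this (hg.congr hg.1.ae_eq_mk) hg.1.measurable_mk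
    rw [WithDensityᵥEq.congr_ae hg.1.ae_eq_mk, this]
    apply integral_congr_ae
    filter_upwards [hg.1.ae_eq_mk] with x hx
    rw [hx]
  have h1 := isFiniteMeasure_withDensity_ofReal hg.2
  have h2 := isFiniteMeasure_withDensity_ofReal hg.neg.2
  have hb : ∀ (μ : Measure X) [IsFiniteMeasure μ], Integrable f μ := fun μ _ =>
    Integrable.of_bound hf.aestronglyMeasurable C (Eventually.of_forall hC)
  rw [withDensityᵥ_eq_withDensity_pos_part_sub_withDensity_neg_part hg,
    VectorMeasure.integral_sub_vectorMeasure, integral_toSignedMeasure_real,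
    integral_toSignedMeasure_real,
    integral_withDensity_eq_integral_toReal_smul (by fun_prop) (by simp),
    integral_withDensity_eq_integral_toReal_smul (by fun_prop) (by simp),
    ← integral_sub]
  · apply integral_congr_ae
    refine Eventually.of_forall fun x => ?_
    simp only [ENNReal.toReal_ofReal', smul_eq_mul]
    rcases le_total 0 (g x) with h | h
    · rw [max_eq_left h, max_eq_right (by linarith)]; ring
    · rw [max_eq_right h, max_eq_left (by linarith)]; ring
  · simp only [ENNReal.toReal_ofReal', smul_eq_mul]
    refine Integrable.mul_bdd (c := C) ?_ hf.aestronglyMeasurable (Eventually.of_forall hC)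
    exact hg.pos_part
  · simp only [ENNReal.toReal_ofReal', smul_eq_mul]
    refine Integrable.mul_bdd (c := C) ?_ hf.aestronglyMeasurable (Eventually.of_forall hC)
    exact hg.neg_part
  · simpa [VectorMeasure.Integrable] using hb _
  · simpa [VectorMeasure.Integrable] using hb _

/-- The primitive `x ↦ ∫ t < x, h t`. -/
def primitive (h : ℝ → ℝ) (x : ℝ) : ℝ := ∫ t in Iio x, h t

theorem abs_primitive_le {h : ℝ → ℝ} (hh : Integrable h) (x : ℝ) :
    |primitive h x| ≤ ∫ t, |h t| :=
  (abs_integral_le_integral_abs).trans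
    (setIntegral_le_integral hh.abs (Eventually.of_forall fun _ => abs_nonneg _))

theorem primitive_sub {h : ℝ → ℝ} (hh : Integrable h) (x y : ℝ) :
    primitive h y - primitive h x = ∫ t in x..y, h t := by
  unfold primitive
  rw [← integral_Iic_eq_integral_Iio, ← integral_Iic_eq_integral_Iio,
    intervalIntegral.integral_Iic_sub_Iic hh.integrableOn hh.integrableOn]

theorem continuous_primitive {h : ℝ → ℝ} (hh : Integrable h) : Continuous (primitive h) := by
  have : primitive h = fun x => primitive h 0 + ∫ t in (0 : ℝ)..x, h t := by
    ext x
    rw [← primitive_sub hh]; ring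
  rw [this]
  exact continuous_const.add
    (intervalIntegral.continuous_primitive (fun _ _ => hh.intervalIntegrable) 0)

/-- Fubini on the region t < x. The strict inequality in `primitive` is what pairs with the open
half-line, so atoms of ν are counted correctly. -/
theorem integral_primitive {h : ℝ → ℝ} (hh : Integrable h) (ν : Measure ℝ) [IsFiniteMeasure ν] :
    ∫ x, primitive h x ∂ν = ∫ t, h t * ν.real (Ioi t) := by
  have hint : Integrable (Function.uncurry fun x t : ℝ => (Iio x).indicator h t)
      (ν.prod volume) := by
    have h1 : Integrable (fun z : ℝ × ℝ => h z.2) (ν.prod volume) := hh.comp_snd ν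
    have h2 : MeasurableSet {z : ℝ × ℝ | z.2 < z.1} :=
      measurableSet_lt measurable_snd measurable_fst
    refine (h1.indicator h2).congr (Eventually.of_forall fun z => ?_)
    simp [Function.uncurry, indicator]
  have : ∀ x, primitive h x = ∫ t, (Iio x).indicator h t := fun x =>
    (integral_indicator measurableSet_Iio).symm
  simp_rw [this]
  rw [integral_integral_swap hint]
  congr 1
  ext t
  have : (fun x => (Iio x).indicator h t) = (Ioi t).indicator fun _ => h t := by
    ext x; simp [indicator]
  rw [this, integral_indicator_const _ measurableSet_Ioi, smul_eq_mul, mul_comm]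

theorem integrable_mul_measureReal_Ioi {h : ℝ → ℝ} (hh : Integrable h) (ν : Measure ℝ)
    [IsFiniteMeasure ν] : Integrable fun t => h t * ν.real (Ioi t) := by
  refine hh.mul_bdd (c := ν.real univ) ?_ (Eventually.of_forall fun t => ?_)
  · refine (Antitone.measurable fun x y hxy => ?_).aestronglyMeasurable
    exact measureReal_mono (Ioi_subset_Ioi hxy)
  · rw [Real.norm_of_nonneg measureReal_nonneg]
    exact measureReal_mono (subset_univ _)

theorem integrable_of_continuous_of_bound {f : ℝ → ℝ} (hf : Continuous f) {C : ℝ}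
    (hC : ∀ x, |f x| ≤ C) (ν : Measure ℝ) [IsFiniteMeasure ν] : Integrable f ν :=
  Integrable.of_bound hf.aestronglyMeasurable C (Eventually.of_forall hC)

/-- Integration by parts for a primitive against a signed measure. -/
theorem integral_primitive_signedMeasure {h : ℝ → ℝ} (hh : Integrable h) (D : SignedMeasure ℝ) :
    ∫ᵛ x, primitive h x ∂•D = ∫ t, h t * D (Ioi t) := by
  rw [integral_signedMeasure_eq (integrable_of_continuous_of_bound (continuous_primitive hh)
    (abs_primitive_le hh) _), integral_primitive hh, integral_primitive hh,
    ← integral_sub (integrable_mul_measureReal_Ioi hh _) (integrable_mul_measureReal_Ioi hh _)]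
  congr 1
  ext t
  rw [D.apply_eq_posPart_real_sub_negPart_real measurableSet_Ioi]
  ring

theorem measurable_signedMeasure_Ioi (D : SignedMeasure ℝ) : Measurable fun t => D (Ioi t) := by
  simp_rw [D.apply_eq_posPart_real_sub_negPart_real measurableSet_Ioi]
  refine Measurable.sub ?_ ?_ <;>
  · refine Antitone.measurable fun x y hxy => ?_
    exact measureReal_mono (Ioi_subset_Ioi hxy)

theorem abs_signedMeasure_le (D : SignedMeasure ℝ) (s : Set ℝ) :
    |D s| ≤ D.totalVariation.real univ :=
  (D.norm_le_totalVariation s).trans (measureReal_mono (subset_univ _))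

theorem tendsto_signedMeasure_of_tendsto_indicator {ι : Type*} {l : Filter ι}
    [l.IsCountablyGenerated] {A : ι → Set X} {B : Set X} (D : SignedMeasure X)
    (hA : ∀ i, MeasurableSet (A i)) (hB : MeasurableSet B)
    (h : ∀ x, ∀ᶠ i in l, x ∈ A i ↔ x ∈ B) : Tendsto (fun i => D (A i)) l (𝓝 (D B)) := by
  have key : ∀ ν : Measure X, IsFiniteMeasure ν →
      Tendsto (fun i => ν.real (A i)) l (𝓝 (ν.real B)) := fun ν _ =>
    (ENNReal.tendsto_toReal (measure_ne_top ν B)).comp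
      (tendsto_measure_of_tendsto_indicator_of_isFiniteMeasure l ν hA h)
  rw [D.apply_eq_posPart_real_sub_negPart_real hB]
  simp_rw [D.apply_eq_posPart_real_sub_negPart_real (hA _)]
  exact (key _ inferInstance).sub (key _ inferInstance)

theorem tendsto_signedMeasure_Ioi_right (D : SignedMeasure ℝ) (a : ℝ) :
    Tendsto (fun t => D (Ioi t)) (𝓝[>] a) (𝓝 (D (Ioi a))) := by
  refine tendsto_signedMeasure_of_tendsto_indicator D (fun _ => measurableSet_Ioi)
    measurableSet_Ioi fun x => ?_
  rcases le_or_gt x a with hx | hx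
  · filter_upwards [self_mem_nhdsWithin] with t ht
    simp only [mem_Ioi] at *
    constructor <;> intro <;> linarith
  · filter_upwards [Ioo_mem_nhdsGT hx] with t ht
    simp [hx, ht.2]

/-- Approaching from the left, the half-lines shrink to the closed one: an atom at b stays in the
limit. -/
theorem tendsto_signedMeasure_Ioi_left (D : SignedMeasure ℝ) (b : ℝ) :
    Tendsto (fun t => D (Ioi t)) (𝓝[<] b) (𝓝 (D (Ici b))) := by
  refine tendsto_signedMeasure_of_tendsto_indicator D (fun _ => measurableSet_Ioi)
    measurableSet_Ici fun x => ?_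
  rcases le_or_gt b x with hx | hx
  · filter_upwards [self_mem_nhdsWithin] with t ht
    simp only [mem_Ioi, mem_Iio, mem_Ici] at *
    constructor <;> intro <;> linarith
  · filter_upwards [Ioo_mem_nhdsLT hx] with t ht
    simp only [mem_Ioi, mem_Ici]
    constructor <;> intro <;> linarith [ht.1]

end

/-! ### Testing the equation with measures of total mass zero -/

section

variable {a b : ℝ}

theorem IsTest.eq_primitive_deriv {η : ℝ → ℝ} (hη : IsTest a b η) : primitive (deriv η) = η := by
  ext x
  have h1 : ContDiff ℝ 1 η := hη.1.of_le (by simp)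
  rw [primitive, ← integral_Iic_eq_integral_Iio, hη.2.1.integral_Iic_deriv_eq h1]

theorem IsTest.integrable_deriv {η : ℝ → ℝ} (hη : IsTest a b η) : Integrable (deriv η) :=
  (hη.1.continuous_deriv (by simp)).integrable_of_hasCompactSupport hη.2.1.deriv

theorem IsTest.eq_zero_of_notMem {η : ℝ → ℝ} (hη : IsTest a b η) {x : ℝ} (hx : x ∉ Ioo a b) :
    η x = 0 :=
  image_eq_zero_of_notMem_tsupport fun h => hx (hη.2.2 h)

theorem IsTest.deriv_eq_zero_of_notMem {η : ℝ → ℝ} (hη : IsTest a b η) {x : ℝ}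
    (hx : x ∉ Ioo a b) : deriv η x = 0 := by
  by_contra h
  exact hx (hη.2.2 (support_deriv_subset h))

theorem apply_inter_of_concentrated {D : SignedMeasure ℝ} (hD : D.restrict (Ioo a b) = D)
    {s : Set ℝ} (hs : MeasurableSet s) : D s = D (s ∩ Ioo a b) := by
  conv_lhs => rw [← hD]
  rw [VectorMeasure.restrict_apply _ measurableSet_Ioo hs]

theorem sing_add_withDensityᵥ (D : SignedMeasure ℝ) :
    sing D + volume.withDensityᵥ (acDensity D) = D :=
  SignedMeasure.singularPart_add_withDensity_rnDeriv_eq ..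

theorem withDensityᵥ_restrict {g : ℝ → ℝ} (hg : Integrable g) {s : Set ℝ} (hs : MeasurableSet s) :
    (volume.withDensityᵥ g).restrict s = volume.withDensityᵥ (s.indicator g) := by
  ext t ht
  rw [VectorMeasure.restrict_apply _ hs ht, withDensityᵥ_apply hg (ht.inter hs),
    withDensityᵥ_apply (hg.indicator hs) ht, setIntegral_indicator hs]

/-- Uniqueness of the Lebesgue decomposition, used to read off both parts of a test measure built by
hand. -/
theorem sing_eq_and_acDensity_ae_eq {D t : SignedMeasure ℝ} {g : ℝ → ℝ} (hg : Integrable g)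
    (ht : t ⟂ᵥ (volume : Measure ℝ).toENNRealVectorMeasure)
    (hD : D = t + volume.withDensityᵥ g) : sing D = t ∧ acDensity D =ᵐ[volume] g :=
  ⟨(SignedMeasure.eq_singularPart t g ht hD).symm, (SignedMeasure.eq_rnDeriv t g hg ht hD).symm⟩

theorem integrable_acDensity (D : SignedMeasure ℝ) : Integrable (acDensity D) :=
  SignedMeasure.integrable_rnDeriv D volume

theorem mutuallySingular_sing (D : SignedMeasure ℝ) :
    sing D ⟂ᵥ (volume : Measure ℝ).toENNRealVectorMeasure :=
  SignedMeasure.mutuallySingular_singularPart D volume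

theorem sing_restrict_and_acDensity_indicator {D : SignedMeasure ℝ}
    (hD : D.restrict (Ioo a b) = D) : (sing D).restrict (Ioo a b) = sing D ∧
      acDensity D =ᵐ[volume] (Ioo a b).indicator (acDensity D) := by
  have h := sing_eq_and_acDensity_ae_eq (D := D) (t := (sing D).restrict (Ioo a b))
    (g := (Ioo a b).indicator (acDensity D))
    ((integrable_acDensity D).indicator measurableSet_Ioo) ?_ ?_
  · exact ⟨h.1.symm, h.2⟩
  · obtain ⟨u, hu, h1, h2⟩ := mutuallySingular_sing D
    refine VectorMeasure.MutuallySingular.mk u hu (fun t ht htm => ?_) (fun t ht htm => h2 t ht)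
    rw [VectorMeasure.restrict_apply _ measurableSet_Ioo htm]
    exact h1 _ (inter_subset_left.trans ht)
  · rw [← withDensityᵥ_restrict (integrable_acDensity D) measurableSet_Ioo,
      ← VectorMeasure.restrict_add, sing_add_withDensityᵥ, hD]

/-- The function `t ↦ -D (t, ∞)` has derivative `D`. -/
theorem hasBVDeriv_neg_Ioi {D : SignedMeasure ℝ} (hD : D.restrict (Ioo a b) = D) :
    HasBVDeriv a b (fun t => -D (Ioi t)) D where
  integrableOn := Measure.integrableOn_of_bounded (M := D.totalVariation.real univ)
    (by simp) (measurable_signedMeasure_Ioi D).neg.aestronglyMeasurable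
    (Eventually.of_forall fun t => by
      rw [norm_neg]; exact abs_signedMeasure_le D _)
  concentrated := hD
  byParts η hη := by
    conv_rhs => rw [← hη.eq_primitive_deriv]
    rw [integral_primitive_signedMeasure hη.integrable_deriv, ← integral_neg,
      setIntegral_eq_integral_of_forall_compl_eq_zero]
    · congr 1; ext t; ring
    · intro x hx
      rw [hη.deriv_eq_zero_of_notMem hx, mul_zero]

/-- The mass-zero condition is needed at this end only; at b the trace vanishes because D does not
charge [b, ∞). -/
theorem hasRightTrace_neg_Ioi {D : SignedMeasure ℝ} (hD : D.restrict (Ioo a b) = D)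
    (h0 : D univ = 0) : HasRightTrace (fun t => -D (Ioi t)) a 0 := by
  have h1 : D (Ioi a) = 0 := by
    rw [← h0, apply_inter_of_concentrated hD measurableSet_Ioi,
      apply_inter_of_concentrated hD MeasurableSet.univ]
    congr 1
    ext x
    simp +contextual
  have := (tendsto_signedMeasure_Ioi_right D a).neg
  rw [h1, neg_zero] at this
  exact this.mono_left inf_le_left

theorem hasLeftTrace_neg_Ioi {D : SignedMeasure ℝ} (hD : D.restrict (Ioo a b) = D) :
    HasLeftTrace (fun t => -D (Ioi t)) b 0 := by
  have h1 : D (Ici b) = 0 := by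
    have : Ici b ∩ Ioo a b = ∅ := by
      ext x
      simp +contextual
    rw [apply_inter_of_concentrated hD measurableSet_Ici, this, VectorMeasure.empty]
  have := (tendsto_signedMeasure_Ioi_left D b).neg
  rw [h1, neg_zero] at this
  exact this.mono_left inf_le_left

/-- The equation that a bounded variation solution satisfies, with the right-hand side integrated
by parts. -/
def FluxEquation (a b : ℝ) (h : ℝ → ℝ) (Du : SignedMeasure ℝ) : Prop :=
  ∀ D : SignedMeasure ℝ, D.restrict (Ioo a b) = D → D univ = 0 →
    (sing D).totalVariation ≪ (sing Du).totalVariation →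
    (∫ x in Ioo a b, acDensity Du x * acDensity D x / √(1 + acDensity Du x ^ 2))
      + ∫ᵛ x, singDir Du x ∂•(sing D) = -∫ᵛ x, primitive ((Ioo a b).indicator h) x ∂•D

theorem IsBVSolution.exists_fluxEquation {f : ℝ → ℝ → ℝ} {u : ℝ → ℝ}
    (hu : IsBVSolution a b f u) :
    ∃ Du : SignedMeasure ℝ, HasBVDeriv a b u Du ∧ IntegrableOn (fun x => f x (u x)) (Ioo a b) ∧
      FluxEquation a b (fun x => f x (u x)) Du := by
  obtain ⟨Du, hDu, hf, h⟩ := hu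
  refine ⟨Du, hDu, hf, fun D hD h0 hs => ?_⟩
  rw [h _ D (hasBVDeriv_neg_Ioi hD) hs (hasRightTrace_neg_Ioi hD h0) (hasLeftTrace_neg_Ioi hD),
    integral_primitive_signedMeasure (hf.integrable_indicator measurableSet_Ioo),
    ← integral_indicator measurableSet_Ioo, ← integral_neg]
  congr 1
  ext t
  by_cases ht : t ∈ Ioo a b <;> simp [ht]

/-- The curvature flux `p / √(1 + p²)`. -/
def flux (p : ℝ) : ℝ := p / √(1 + p ^ 2)

theorem continuous_flux : Continuous flux :=
  continuous_id.div (by fun_prop) fun p => by positivity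

theorem one_sub_flux_sq (p : ℝ) : 1 - flux p ^ 2 = 1 / (1 + p ^ 2) := by
  have : (0 : ℝ) < 1 + p ^ 2 := by positivity
  rw [flux, div_pow, Real.sq_sqrt this.le]
  field_simp
  ring

theorem abs_flux_lt_one (p : ℝ) : |flux p| < 1 := by
  rw [← sq_lt_one_iff_abs_lt_one, ← sub_pos, one_sub_flux_sq]
  positivity

/-- The inverse of the flux, by which D^a u is recovered from W. -/
theorem flux_div (p : ℝ) : flux p / √(1 - flux p ^ 2) = p := by
  have : (0 : ℝ) < √(1 + p ^ 2) := by positivity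
  rw [one_sub_flux_sq, Real.sqrt_div zero_le_one, Real.sqrt_one, flux]
  field_simp

/-! ### The flux is m - P, and the singular part vanishes -/

variable {h : ℝ → ℝ} {Du : SignedMeasure ℝ}

/-- Du Bois-Reymond argument: the test density w + P - m, with w the flux, turns the equation into ∫
(w + P - m)² = 0. -/
theorem FluxEquation.exists_flux_ae_eq (hab : a < b) (hh : IntegrableOn h (Ioo a b))
    (H : FluxEquation a b h Du) :
    ∃ m, ∀ᵐ x ∂volume.restrict (Ioo a b),
      flux (acDensity Du x) = m - primitive ((Ioo a b).indicator h) x := by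
  have hh0 : Integrable ((Ioo a b).indicator h) := hh.integrable_indicator measurableSet_Ioo
  set P := primitive ((Ioo a b).indicator h) with hP
  have hPc : Continuous P := continuous_primitive hh0
  obtain ⟨C, hC⟩ : ∃ C, ∀ x, |P x| ≤ C := ⟨_, abs_primitive_le hh0⟩
  set w : ℝ → ℝ := fun x => flux (acDensity Du x) with hw
  have hwm : Measurable w :=
    continuous_flux.measurable.comp (SignedMeasure.measurable_rnDeriv Du volume)
  have hwb : ∀ x, |w x| ≤ 1 := fun x => (abs_flux_lt_one _).le
  -- The mean of w + P, so that the test measure has total mass zero.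
  set m := (∫ x in Ioo a b, (w x + P x)) / (b - a) with hm
  have hbd : ∀ g : ℝ → ℝ, Measurable g → ∀ M, (∀ x, |g x| ≤ M) → IntegrableOn g (Ioo a b) :=
    fun g hg M hM => Measure.integrableOn_of_bounded (M := M) (by simp)
      hg.aestronglyMeasurable (Eventually.of_forall hM)
  have hgm : Measurable fun x => w x + P x - m := by fun_prop
  have hgb : ∀ x, |w x + P x - m| ≤ 1 + C + |m| := fun x => by
    refine (abs_sub _ _).trans ?_
    have := abs_add_le (w x) (P x)
    linarith [hwb x, hC x]
  have hgi := hbd _ hgm _ hgb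
  set ψ := (Ioo a b).indicator fun x => w x + P x - m with hψ
  have hψi : Integrable ψ := hgi.integrable_indicator measurableSet_Ioo
  have hwP : IntegrableOn (fun x => w x + P x) (Ioo a b) :=
    (hbd w hwm 1 hwb).add (hbd P hPc.measurable C hC)
  have hmean : ∫ x in Ioo a b, (w x + P x - m) = 0 := by
    rw [integral_sub hwP (by simp), hm]
    simp [hab.le]
    have : b - a ≠ 0 := by linarith
    field_simp
    ring
  obtain ⟨hs, hd⟩ := sing_eq_and_acDensity_ae_eq (D := volume.withDensityᵥ ψ) (t := 0) hψi
    (VectorMeasure.MutuallySingular.zero_left) (by simp)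
  have key := H (volume.withDensityᵥ ψ)
    (by rw [withDensityᵥ_restrict hψi measurableSet_Ioo, hψ, indicator_indicator, inter_self])
    (by rw [withDensityᵥ_apply hψi MeasurableSet.univ, setIntegral_univ, hψ,
          integral_indicator measurableSet_Ioo, hmean])
    (by rw [hs, SignedMeasure.totalVariation_zero]; exact Measure.AbsolutelyContinuous.zero _)
  rw [hs, VectorMeasure.integral_zero_vectorMeasure, add_zero,
    integral_withDensityᵥ hψi hPc.stronglyMeasurable hC] at key
  have e1 : ∫ x in Ioo a b, acDensity Du x * acDensity (volume.withDensityᵥ ψ) x /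
      √(1 + acDensity Du x ^ 2) = ∫ x in Ioo a b, w x * (w x + P x - m) := by
    apply integral_congr_ae
    filter_upwards [ae_restrict_of_ae hd, ae_restrict_mem measurableSet_Ioo] with x hx hxI
    rw [hx, hψ, indicator_of_mem hxI, hw]
    simp only [flux]
    ring
  have e2 : ∫ x, P x * ψ x = ∫ x in Ioo a b, P x * (w x + P x - m) := by
    rw [← integral_indicator measurableSet_Ioo]
    congr 1
    ext x
    by_cases hx : x ∈ Ioo a b <;> simp [hψ, hx]
  rw [e1, e2] at key
  have hwi : IntegrableOn (fun x => w x * (w x + P x - m)) (Ioo a b) :=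
    Integrable.bdd_mul (c := 1) hgi hwm.aestronglyMeasurable (Eventually.of_forall hwb)
  have hPi : IntegrableOn (fun x => P x * (w x + P x - m)) (Ioo a b) :=
    Integrable.bdd_mul (c := C) hgi hPc.aestronglyMeasurable (Eventually.of_forall hC)
  have hsq : ∫ x in Ioo a b, (w x + P x - m) ^ 2 = 0 := by
    have : ∀ x, (w x + P x - m) ^ 2 =
      (w x * (w x + P x - m) + P x * (w x + P x - m)) - m * (w x + P x - m) := fun x => by ring
    simp_rw [this]
    rw [integral_sub (f := fun x => w x * (w x + P x - m) + P x * (w x + P x - m))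
      (hwi.add hPi) (hgi.const_mul m), integral_add hwi hPi,
      integral_const_mul, hmean, key]
    ring
  refine ⟨m, ?_⟩
  rw [integral_eq_zero_iff_of_nonneg (fun x => sq_nonneg _)] at hsq
  · filter_upwards [hsq] with x hx
    have : w x + P x - m = 0 := by simpa using hx
    change w x = _
    linarith
  · refine ((hwi.add hPi).sub (hgi.const_mul m)).congr (Eventually.of_forall fun x => ?_)
    simp only [Pi.add_apply, Pi.sub_apply]
    ring

/-- On a Hahn decomposition the density is +1 on the positive part and -1 on the negative part. -/
theorem integral_singDir (D : SignedMeasure ℝ) :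
    ∫ᵛ x, singDir D x ∂•(sing D) = (sing D).totalVariation.real univ := by
  set s := sing D with hs
  set j := s.toJordanDecomposition with hj
  obtain ⟨S, hS, -, -, h1, h2⟩ := j.exists_compl_positive_negative
  have hpos : s.totalVariation.restrict Sᶜ = j.posPart := by
    rw [SignedMeasure.totalVariation, Measure.restrict_add, Measure.restrict_eq_zero.2 h2,
      add_zero, Measure.restrict_eq_self_of_ae_mem]
    rw [ae_iff]; simpa using h1
  have hneg : s.totalVariation.restrict S = j.negPart := by
    rw [SignedMeasure.totalVariation, Measure.restrict_add, Measure.restrict_eq_zero.2 h1,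
      zero_add, Measure.restrict_eq_self_of_ae_mem]
    rw [ae_iff]; exact h2
  have e1 := Measure.rnDeriv_restrict_self s.totalVariation hS.compl
  have e2 := Measure.rnDeriv_restrict_self s.totalVariation hS
  rw [hpos] at e1
  rw [hneg] at e2
  have e : singDir D =ᵐ[s.totalVariation] fun x => Sᶜ.indicator 1 x - S.indicator 1 x := by
    filter_upwards [e1, e2] with x h1 h2
    simp only [singDir, SignedMeasure.rnDeriv, ← hs, ← hj, h1, h2]
    by_cases hx : x ∈ S <;> simp [hx]
  have ep : singDir D =ᵐ[j.posPart] fun _ => 1 := by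
    rw [← hpos]
    filter_upwards [ae_restrict_of_ae e, ae_restrict_mem hS.compl] with x hx hxS
    rw [hx]
    have : x ∉ S := hxS
    simp [this]
  have en : singDir D =ᵐ[j.negPart] fun _ => -1 := by
    rw [← hneg]
    filter_upwards [ae_restrict_of_ae e, ae_restrict_mem hS] with x hx hxS
    rw [hx]
    simp [hxS]
  rw [integral_signedMeasure_eq (f := singDir D) (SignedMeasure.integrable_rnDeriv _ _), ← hj,
    integral_congr_ae ep, integral_congr_ae en, SignedMeasure.totalVariation,
    measureReal_add_apply]
  simp [← hj]

/-- The equality gives |s|(ℝ) ≤ ∫ |W| d|s|, hence ∫ (1 - |W|) d|s| = 0, while the integrand is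
strictly positive wherever s lives. -/
theorem eq_zero_of_abs_lt_one {s : SignedMeasure ℝ} (hs : s.restrict (Ioo a b) = s) {W : ℝ → ℝ}
    (hW : Continuous W) {C : ℝ} (hC : ∀ x, |W x| ≤ C) (h1 : ∀ x ∈ Ioo a b, |W x| < 1)
    (h : ∫ᵛ x, W x ∂•s = s.totalVariation.real univ) : s = 0 := by
  have hWi : Integrable W s.totalVariation := integrable_of_continuous_of_bound hW hC _
  have hmem : ∀ᵐ x ∂s.totalVariation, x ∈ Ioo a b := by
    have h2 := congrArg VectorMeasure.variation hs
    rw [VectorMeasure.variation_restrict measurableSet_Ioo,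
      ← SignedMeasure.totalVariation_eq_variation] at h2
    rw [← h2]
    exact ae_restrict_mem measurableSet_Ioo
  have hle : ∫ᵛ x, W x ∂•s ≤ ∫ x, |W x| ∂s.totalVariation := by
    refine (le_abs_self _).trans ?_
    rw [← Real.norm_eq_abs]
    refine VectorMeasure.norm_integral_le_integral_norm.trans ?_
    rw [SignedMeasure.totalVariation_eq_variation]
    refine mul_le_of_le_one_left (integral_nonneg fun _ => norm_nonneg _) ?_
    exact ContinuousLinearMap.opNorm_lsmul_le
  have h0 : ∫ x, (1 - |W x|) ∂s.totalVariation = 0 := by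
    refine le_antisymm ?_ (integral_nonneg_of_ae ?_)
    · rw [integral_sub (integrable_const _) hWi.abs]
      simp only [integral_const, smul_eq_mul, mul_one]
      linarith
    · filter_upwards [hmem] with x hx
      simpa using (h1 x hx).le
  rw [integral_eq_zero_iff_of_nonneg_ae] at h0
  · have hz : s.totalVariation = 0 := by
      rw [← ae_eq_bot, ← Filter.eventually_false_iff_eq_bot]
      filter_upwards [hmem, h0] with x hx hx0
      have := h1 x hx
      simp only [Pi.zero_apply] at hx0
      linarith
    ext t ht
    exact s.null_of_totalVariation_zero (by rw [hz]; simp)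
  · filter_upwards [hmem] with x hx
    simpa using (h1 x hx).le
  · exact (integrable_const _).sub hWi.abs

/-- The test measure has the same singular part as Du, and an absolutely continuous part that only
balances the mass. By the flux identity the absolutely continuous contributions cancel, leaving ∫ W
dD^s u = |D^s u|. -/
theorem FluxEquation.sing_eq_zero (hab : a < b) (hh : IntegrableOn h (Ioo a b))
    (hDu : Du.restrict (Ioo a b) = Du) (H : FluxEquation a b h Du) {m : ℝ}
    (hm : ∀ᵐ x ∂volume.restrict (Ioo a b),
      flux (acDensity Du x) = m - primitive ((Ioo a b).indicator h) x)
    (h1 : ∀ x ∈ Ioo a b, |m - primitive ((Ioo a b).indicator h) x| < 1) : sing Du = 0 := by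
  have hh0 : Integrable ((Ioo a b).indicator h) := hh.integrable_indicator measurableSet_Ioo
  set P := primitive ((Ioo a b).indicator h) with hP
  have hPc : Continuous P := continuous_primitive hh0
  obtain ⟨C, hC⟩ : ∃ C, ∀ x, |P x| ≤ C := ⟨_, abs_primitive_le hh0⟩
  obtain ⟨hsr, hd0⟩ := sing_restrict_and_acDensity_indicator hDu
  set p := acDensity Du with hp
  -- Subtracting this constant from D^a u makes the total mass of the test measure zero.
  set k := Du univ / (b - a) with hk
  set ψ : ℝ → ℝ := (Ioo a b).indicator fun x => p x - k with hψ
  have hpi : Integrable p := integrable_acDensity Du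
  have hpk : IntegrableOn (fun x => p x - k) (Ioo a b) := hpi.integrableOn.sub (by simp)
  have hψi : Integrable ψ := hpk.integrable_indicator measurableSet_Ioo
  set D := sing Du + volume.withDensityᵥ ψ with hD
  obtain ⟨hs, hd⟩ := sing_eq_and_acDensity_ae_eq (D := D) hψi (mutuallySingular_sing Du) hD
  have hDr : D.restrict (Ioo a b) = D := by
    rw [hD, VectorMeasure.restrict_add, hsr, withDensityᵥ_restrict hψi measurableSet_Ioo, hψ,
      indicator_indicator, inter_self]
  have hD0 : D univ = 0 := by
    have e := congrArg (fun μ : SignedMeasure ℝ => μ univ) (sing_add_withDensityᵥ Du)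
    simp only [_root_.add_apply] at e
    rw [withDensityᵥ_apply (integrable_acDensity Du) MeasurableSet.univ, setIntegral_univ,
      integral_congr_ae hd0, integral_indicator measurableSet_Ioo] at e
    rw [hD, _root_.add_apply, withDensityᵥ_apply hψi MeasurableSet.univ, setIntegral_univ,
      hψ, integral_indicator measurableSet_Ioo, integral_sub hpi.integrableOn (by simp)]
    simp only [integral_const, hk, smul_eq_mul]
    simp [hab.le]
    have : b - a ≠ 0 := by linarith
    field_simp
    linarith
  have key := H D hDr hD0 (by rw [hs])
  have hV : ∀ (μ : SignedMeasure ℝ), μ.Integrable P := fun μ => by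
    rw [VectorMeasure.Integrable, ← SignedMeasure.totalVariation_eq_variation]
    exact integrable_of_continuous_of_bound hPc hC _
  have hVc : ∀ (μ : SignedMeasure ℝ), μ.Integrable fun _ : ℝ => m := fun μ => by
    rw [VectorMeasure.Integrable, ← SignedMeasure.totalVariation_eq_variation]
    exact integrable_const _
  have hsD : ∀ μ : SignedMeasure ℝ, IsFiniteMeasure μ.variation := fun μ => by
    rw [← SignedMeasure.totalVariation_eq_variation]; infer_instance
  have := hsD D
  have := hsD (sing Du)
  -- Since D has mass zero, the constant m may be added freely, so the right-hand side is an
  -- integral of W.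
  have e1 : ∫ᵛ x, m - P x ∂•D = -∫ᵛ x, P x ∂•D := by
    rw [VectorMeasure.integral_fun_sub (hVc _) (hV _), VectorMeasure.integral_const, hD0]
    simp
  have hWb : ∀ x, |m - P x| ≤ |m| + C := fun x => by
    have := abs_sub m (P x)
    linarith [hC x]
  have hWc : Continuous fun x => m - P x := by fun_prop
  have e2 : ∫ᵛ x, m - P x ∂•D = ∫ᵛ x, m - P x ∂•(sing Du) + ∫ x, (m - P x) * ψ x := by
    rw [hD, VectorMeasure.integral_add_vectorMeasure ((hVc _).fun_sub (hV _))
      ((hVc _).fun_sub (hV _)),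
      integral_withDensityᵥ hψi hWc.stronglyMeasurable hWb]
  have e3 : ∫ x in Ioo a b, p x * acDensity D x / √(1 + p x ^ 2) = ∫ x, (m - P x) * ψ x := by
    have : ∫ x, (m - P x) * ψ x = ∫ x in Ioo a b, (m - P x) * ψ x := by
      rw [setIntegral_eq_integral_of_forall_compl_eq_zero]
      intro x hx
      simp [hψ, hx]
    rw [this]
    apply integral_congr_ae
    filter_upwards [ae_restrict_of_ae hd, hm] with x hx hx2
    rw [hx, ← hx2, flux]
    ring
  rw [e3, hs, integral_singDir, ← e1, e2] at key
  exact eq_zero_of_abs_lt_one hsr hWc hWb h1 (by linarith)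

end

/-! ### Excluding |W| = 1 under a sign change -/

section

theorem intervalIntegral_mono_of_ae_Ioo {g k : ℝ → ℝ} {x y : ℝ} (hxy : x ≤ y)
    (hg : IntegrableOn g (Ioo x y)) (hk : IntegrableOn k (Ioo x y))
    (h : ∀ᵐ t ∂volume.restrict (Ioo x y), g t ≤ k t) : ∫ t in x..y, g t ≤ ∫ t in x..y, k t := by
  rw [intervalIntegral.integral_of_le hxy, intervalIntegral.integral_of_le hxy,
    integral_Ioc_eq_integral_Ioo, integral_Ioc_eq_integral_Ioo]
  exact integral_mono_ae hg hk h

theorem intervalIntegral_nonneg_of_ae_Ioo {g : ℝ → ℝ} {x y : ℝ} (hxy : x ≤ y)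
    (h : ∀ᵐ t ∂volume.restrict (Ioo x y), 0 ≤ g t) : 0 ≤ ∫ t in x..y, g t := by
  rw [intervalIntegral.integral_of_le hxy, integral_Ioc_eq_integral_Ioo]
  exact integral_nonneg_of_ae h

theorem intervalIntegral_nonpos_of_ae_Ioo {g : ℝ → ℝ} {x y : ℝ} (hxy : x ≤ y)
    (h : ∀ᵐ t ∂volume.restrict (Ioo x y), g t ≤ 0) : ∫ t in x..y, g t ≤ 0 := by
  rw [intervalIntegral.integral_of_le hxy, integral_Ioc_eq_integral_Ioo]
  exact integral_nonpos_of_ae h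

theorem exists_abs_lt_one_of_ae {a b α β : ℝ} {W : ℝ → ℝ} (hαβ : α < β)
    (hsub : Ioo α β ⊆ Ioo a b) (h : ∀ᵐ x ∂volume.restrict (Ioo a b), |W x| < 1) :
    ∃ x ∈ Ioo α β, |W x| < 1 := by
  have h' := ae_restrict_of_ae_restrict_of_subset hsub h
  have hne : NeBot (ae (volume.restrict (Ioo α β))) := by
    rw [ae_neBot, Ne, Measure.restrict_eq_zero]
    simpa using hαβ
  obtain ⟨x, hx⟩ := (h'.and (ae_restrict_mem measurableSet_Ioo)).exists
  exact ⟨x, hx.2, hx.1⟩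

/-- If `W` is close to `-1` at a rate controlled by `M`, then integrability of `W / √(1 - W²)`
implies that of `1 / √M`. -/
theorem lintegral_one_div_sqrt_lt_top {S K : Set ℝ} {W M : ℝ → ℝ} (hSm : MeasurableSet S)
    (hS : volume S ≠ ⊤) (hK : IsCompact K) (hMc : ContinuousOn M K) (hMK : ∀ x ∈ K, 0 < M x)
    (hM : ∀ x ∈ S, 0 < M x) (hWM : ∀ x ∈ S, 1 + W x ≤ M x) (hWS : ∀ x ∈ S, x ∉ K → W x ≤ -(1 / 2))
    (hW1 : ∀ᵐ x ∂volume.restrict S, |W x| < 1)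
    (hint : IntegrableOn (fun x => W x / √(1 - W x ^ 2)) S) :
    ∫⁻ x in S, ENNReal.ofReal (1 / √(M x)) < ⊤ := by
  obtain ⟨C, hC⟩ := hK.exists_bound_of_continuousOn (f := fun x => 1 / √(M x))
    (continuousOn_const.div hMc.sqrt fun x hx => (Real.sqrt_pos.2 (hMK x hx)).ne')
  have hbound : ∀ᵐ x ∂volume.restrict S,
      1 / √(M x) ≤ |C| + 4 * |W x / √(1 - W x ^ 2)| := by
    filter_upwards [hW1, ae_restrict_mem hSm] with x hx hxS
    by_cases hxK : x ∈ K
    · have := (le_abs_self _).trans (hC x hxK)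
      have h2 := le_abs_self C
      have h3 := abs_nonneg (W x / √(1 - W x ^ 2))
      linarith
    · have hw := hWS x hxS hxK
      have hm := hM x hxS
      have hwm := hWM x hxS
      rw [abs_lt] at hx
      have h1 : 0 < 1 - W x ^ 2 := by nlinarith
      have hs1 : 0 < √(1 - W x ^ 2) := Real.sqrt_pos.2 h1
      -- 1 - W² = (1 + W)(1 - W) with first factor at most M and second below 2. Together with -W ≥
      -- 1/2 this yields the factor 4.
      have hle : √(1 - W x ^ 2) ≤ 2 * √(M x) := by
        rw [Real.sqrt_le_left (by positivity), mul_pow, Real.sq_sqrt hm.le]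
        nlinarith
      rw [abs_div, abs_of_pos hs1, abs_of_neg (show W x < 0 by linarith)]
      have : 1 / √(M x) ≤ 4 * (-W x / √(1 - W x ^ 2)) := by
        rw [mul_div_assoc', div_le_div_iff₀ (Real.sqrt_pos.2 hm) hs1]
        nlinarith [Real.sqrt_pos.2 hm]
      linarith [abs_nonneg C]
  have hfin : IntegrableOn (fun x => |C| + 4 * |W x / √(1 - W x ^ 2)|) S :=
    (integrableOn_const hS).add (hint.abs.const_mul 4)
  refine (lintegral_mono_ae (hbound.mono fun x hx => ENNReal.ofReal_le_ofReal hx)).trans_lt ?_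
  refine lt_of_le_of_lt (lintegral_mono fun x => ?_) hfin.2
  exact Real.ofReal_le_enorm _

/-- W has its minimum at c, so the lower bound reduces to W(c) > -1, which the divergence hypothesis
on either side provides. The upper bound follows from monotonicity and the a.e. bound. -/
theorem abs_lt_one_of_sign_change {a b c : ℝ} {h W : ℝ → ℝ} (hc : c ∈ Ioo a b)
    (hh : IntegrableOn h (Ioo a b)) (hW : Continuous W)
    (hd : ∀ x ∈ Icc a b, ∀ y ∈ Icc a b, W x - W y = ∫ t in x..y, h t)
    (hW1 : ∀ᵐ x ∂volume.restrict (Ioo a b), |W x| < 1)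
    (hint : IntegrableOn (fun x => W x / √(1 - W x ^ 2)) (Ioo a b))
    (hl : ∀ᵐ x ∂volume.restrict (Ioo a c), 0 ≤ h x)
    (hr : ∀ᵐ x ∂volume.restrict (Ioo c b), h x ≤ 0)
    (hdiv : (∃ δ > 0, a ≤ c - δ ∧ ∃ μ : ℝ → ℝ, IntegrableOn μ (Ioo (c - δ) c) ∧
            (∀ᵐ x ∂volume.restrict (Ioo (c - δ) c), h x ≤ μ x) ∧
            (∀ x ∈ Ico (c - δ) c, 0 < ∫ t in x..c, μ t) ∧
            ∫⁻ x in Ioo (c - δ) c, ENNReal.ofReal (1 / √(∫ t in x..c, μ t)) = ⊤) ∨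
         (∃ δ > 0, c + δ ≤ b ∧ ∃ ν : ℝ → ℝ, IntegrableOn ν (Ioo c (c + δ)) ∧
            (∀ᵐ x ∂volume.restrict (Ioo c (c + δ)), ν x ≤ h x) ∧
            (∀ x ∈ Ioc c (c + δ), ∫ t in c..x, ν t < 0) ∧
            ∫⁻ x in Ioo c (c + δ), ENNReal.ofReal (1 / √(-∫ t in c..x, ν t)) = ⊤)) :
    ∀ x ∈ Ioo a b, |W x| < 1 := by
  have hcI : c ∈ Icc a b := ⟨hc.1.le, hc.2.le⟩
  have hL : ∀ x ∈ Icc a c, ∀ y ∈ Icc a c, x ≤ y → W y ≤ W x := fun x hx y hy hxy => by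
    have h1 := hd x ⟨hx.1, hx.2.trans hc.2.le⟩ y ⟨hy.1, hy.2.trans hc.2.le⟩
    have h2 := intervalIntegral_nonneg_of_ae_Ioo hxy
      (ae_restrict_of_ae_restrict_of_subset (Ioo_subset_Ioo hx.1 hy.2) hl)
    linarith
  have hR : ∀ x ∈ Icc c b, ∀ y ∈ Icc c b, x ≤ y → W x ≤ W y := fun x hx y hy hxy => by
    have h1 := hd x ⟨hc.1.le.trans hx.1, hx.2⟩ y ⟨hc.1.le.trans hy.1, hy.2⟩
    have h2 := intervalIntegral_nonpos_of_ae_Ioo hxy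
      (ae_restrict_of_ae_restrict_of_subset (Ioo_subset_Ioo hx.1 hy.2) hr)
    linarith
  have hcW : -1 < W c := by
    by_contra! hcon
    have hev : ∀ᶠ x in 𝓝 c, W x < -(1 / 2) :=
      hW.continuousAt.eventually_lt continuousAt_const (by linarith)
    obtain ⟨ε, hε, hball⟩ := Metric.eventually_nhds_iff.1 hev
    rcases hdiv with ⟨δ, hδ, haδ, μ, hμi, hμ, hμp, hμd⟩ | ⟨δ, hδ, hbδ, ν, hνi, hν, hνn, hνd⟩
    · have hsub : Ioo (c - δ) c ⊆ Ioo a b := Ioo_subset_Ioo haδ hc.2.le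
      -- Away from c, M is bounded below by compactness; within ε of c, W < -1/2. If ε > δ the
      -- compact set is empty, which is harmless.
      refine (lintegral_one_div_sqrt_lt_top (W := W) (K := Icc (c - δ) (c - ε)) measurableSet_Ioo
        (by simp) isCompact_Icc ?_ ?_ ?_ ?_ ?_ ?_ ?_).ne hμd
      · have hμI : IntervalIntegrable μ volume (c - δ) c := by
          rwa [intervalIntegrable_iff_integrableOn_Ioo_of_le (by linarith)]
        have hcont := intervalIntegral.continuousOn_primitive_interval' hμI.symm left_mem_uIcc
        rw [uIcc_of_ge (by linarith)] at hcont
        refine (hcont.neg.congr fun x _ => ?_).mono (Icc_subset_Icc_right (by linarith))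
        exact intervalIntegral.integral_symm ..
      · exact fun x hx => hμp x ⟨hx.1, by linarith [hx.2]⟩
      · exact fun x hx => hμp x ⟨hx.1.le, hx.2⟩
      · intro x hx
        -- Here 1 + W(x) ≤ W(x) - W(c) = ∫ h over (x, c), which is at most M(x).
        have h1 := hd x ⟨haδ.trans hx.1.le, hx.2.le.trans hc.2.le⟩ c hcI
        have hs : Ioo x c ⊆ Ioo (c - δ) c := Ioo_subset_Ioo_left hx.1.le
        have h2 := intervalIntegral_mono_of_ae_Ioo hx.2.le (hh.mono_set (hs.trans hsub))
          (hμi.mono_set hs) (ae_restrict_of_ae_restrict_of_subset hs hμ)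
        linarith
      · intro x hx hxK
        have : c - ε < x := by
          by_contra! h'
          exact hxK ⟨hx.1.le, h'⟩
        refine (hball ?_).le
        rw [Real.dist_eq, abs_lt]
        constructor <;> linarith [hx.2]
      · exact ae_restrict_of_ae_restrict_of_subset hsub hW1
      · exact hint.mono_set hsub
    · have hsub : Ioo c (c + δ) ⊆ Ioo a b := Ioo_subset_Ioo hc.1.le hbδ
      refine (lintegral_one_div_sqrt_lt_top (W := W) (K := Icc (c + ε) (c + δ)) measurableSet_Ioo
        (by simp) isCompact_Icc ?_ ?_ ?_ ?_ ?_ ?_ ?_).ne hνd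
      · have hνI : IntervalIntegrable ν volume c (c + δ) := by
          rwa [intervalIntegrable_iff_integrableOn_Ioo_of_le (by linarith)]
        have hcont := intervalIntegral.continuousOn_primitive_interval' hνI left_mem_uIcc
        rw [uIcc_of_le (by linarith)] at hcont
        exact hcont.neg.mono (Icc_subset_Icc_left (by linarith))
      · exact fun x hx => neg_pos.2 (hνn x ⟨by linarith [hx.1], hx.2⟩)
      · exact fun x hx => neg_pos.2 (hνn x ⟨hx.1, hx.2.le⟩)
      · intro x hx
        have h1 := hd c hcI x ⟨hc.1.le.trans hx.1.le, hx.2.le.trans hbδ⟩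
        have hs : Ioo c x ⊆ Ioo c (c + δ) := Ioo_subset_Ioo_right hx.2.le
        have h2 := intervalIntegral_mono_of_ae_Ioo hx.1.le (hνi.mono_set hs)
          (hh.mono_set (hs.trans hsub)) (ae_restrict_of_ae_restrict_of_subset hs hν)
        linarith
      · intro x hx hxK
        have : x < c + ε := by
          by_contra! h'
          exact hxK ⟨h', hx.2.le⟩
        refine (hball ?_).le
        rw [Real.dist_eq, abs_lt]
        constructor <;> linarith [hx.1]
      · exact ae_restrict_of_ae_restrict_of_subset hsub hW1
      · exact hint.mono_set hsub
  intro x hx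
  rw [abs_lt]
  rcases le_total x c with hxc | hxc
  · constructor
    · exact hcW.trans_le (hL x ⟨hx.1.le, hxc⟩ c ⟨hc.1.le, le_rfl⟩ hxc)
    -- Some y between a and x has W(y) < 1, and W only decreases from y to x.
    · obtain ⟨y, hy, hy1⟩ := exists_abs_lt_one_of_ae hx.1 (Ioo_subset_Ioo_right hx.2.le) hW1
      exact (hL y ⟨hy.1.le, hy.2.le.trans hxc⟩ x ⟨hx.1.le, hxc⟩ hy.2.le).trans_lt (abs_lt.1 hy1).2
  · constructor
    · exact hcW.trans_le (hR c ⟨le_rfl, hc.2.le⟩ x ⟨hxc, hx.2.le⟩ hxc)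
    · obtain ⟨y, hy, hy1⟩ := exists_abs_lt_one_of_ae hx.2 (Ioo_subset_Ioo_left hx.1.le) hW1
      exact (hR x ⟨hxc, hx.2.le⟩ y ⟨hxc.trans hy.1.le, hy.2.le⟩ hy.1.le).trans_lt (abs_lt.1 hy1).2

end

/-! ### Absolute continuity, weak derivatives and regularity -/

section

variable {a b : ℝ}

theorem exists_Ioo_of_isCompact {K : Set ℝ} (hab : a < b) (hK : IsCompact K) (hKI : K ⊆ Ioo a b) :
    ∃ α β, a < α ∧ α < β ∧ β < b ∧ K ⊆ Ioo α β := by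
  rcases K.eq_empty_or_nonempty with rfl | hne
  · obtain ⟨α, h1, h2⟩ := exists_between hab
    obtain ⟨β, h3, h4⟩ := exists_between h2
    exact ⟨α, β, h1, h3, h4, empty_subset _⟩
  · obtain ⟨x, hx, hxl⟩ := hK.exists_isLeast hne
    obtain ⟨y, hy, hyg⟩ := hK.exists_isGreatest hne
    obtain ⟨α, h1, h2⟩ := exists_between (hKI hx).1
    obtain ⟨β, h3, h4⟩ := exists_between (hKI hy).2
    exact ⟨α, β, h1, (h2.trans_le (hxl hy)).trans h3, h4,
      fun z hz => ⟨h2.trans_le (hxl hz), (hyg hz).trans_lt h3⟩⟩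

theorem primitive_eq_add {φ : ℝ → ℝ} (hφ : Integrable φ) (x : ℝ) :
    primitive φ = fun y => primitive φ x + ∫ t in x..y, φ t := by
  ext y
  rw [← primitive_sub hφ]; ring

theorem hasDerivAt_primitive {φ : ℝ → ℝ} (hφ : Integrable φ) {x : ℝ} (hx : ContinuousAt φ x) :
    HasDerivAt (primitive φ) (φ x) x := by
  rw [primitive_eq_add hφ x]
  exact (intervalIntegral.integral_hasDerivAt_right hφ.intervalIntegrable
    (hφ.1.stronglyMeasurableAtFilter) hx).const_add _

theorem ae_hasDerivAt_primitive {φ : ℝ → ℝ} (hφ : Integrable φ) :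
    ∀ᵐ x, HasDerivAt (primitive φ) (φ x) x := by
  filter_upwards [LocallyIntegrable.ae_hasDerivAt_integral hφ.locallyIntegrable] with x hx
  rw [primitive_eq_add hφ 0]
  exact (hx 0).const_add _

theorem absolutelyContinuous_primitive {φ : ℝ → ℝ} (hφ : Integrable φ) (α β : ℝ) :
    AbsolutelyContinuousOnInterval (primitive φ) α β := by
  rw [primitive_eq_add hφ α]
  have h1 : AbsolutelyContinuousOnInterval (fun _ : ℝ => primitive φ α) α β :=
    contDiffOn_const.absolutelyContinuousOnInterval
  exact h1.add (hφ.intervalIntegrable.absolutelyContinuousOnInterval_intervalIntegral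
    left_mem_uIcc)

/-- The image of the interval under W is compact and convex, so the C¹ function G is Lipschitz on
it. -/
theorem absolutelyContinuous_comp {W G : ℝ → ℝ} {s : Set ℝ} {α β : ℝ}
    (hW : AbsolutelyContinuousOnInterval W α β) (hG : ContDiffOn ℝ 1 G s)
    (hs : MapsTo W (uIcc α β) s) :
    AbsolutelyContinuousOnInterval (fun x => G (W x)) α β := by
  obtain ⟨K, hK⟩ := (hG.mono hs.image_subset).exists_lipschitzOnWith (by decide)
    ((isPreconnected_uIcc.image W hW.continuousOn).ordConnected.convex)
    (isCompact_uIcc.image_of_continuousOn hW.continuousOn)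
  rw [absolutelyContinuousOnInterval_iff] at hW ⊢
  intro ε hε
  -- K + 1 rather than K, as the Lipschitz constant may be zero.
  obtain ⟨δ, hδ, h⟩ := hW (ε / (K + 1)) (by positivity)
  refine ⟨δ, hδ, fun E hE hEδ => ?_⟩
  have h1 := h E hE hEδ
  have hK1 : (0 : ℝ) < K + 1 := by positivity
  calc ∑ i ∈ Finset.range E.1, dist (G (W (E.2 i).1)) (G (W (E.2 i).2))
      ≤ ∑ i ∈ Finset.range E.1, (K + 1) * dist (W (E.2 i).1) (W (E.2 i).2) := by
        refine Finset.sum_le_sum fun i hi => ?_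
        obtain ⟨h2, h3⟩ := hE.1 i hi
        refine (hK.dist_le_mul _ (mem_image_of_mem W h2) _ (mem_image_of_mem W h3)).trans ?_
        gcongr
        linarith
    _ < ε := by
        rw [← Finset.mul_sum]
        rwa [lt_div_iff₀' hK1] at h1

/-- A locally absolutely continuous function has its almost everywhere derivative as a weak
derivative. -/
theorem hasWeakDeriv_of_absolutelyContinuous {F F' : ℝ → ℝ} (hab : a < b)
    (hF : LocallyIntegrableOn F (Ioo a b)) (hF' : LocallyIntegrableOn F' (Ioo a b))
    (hac : ∀ α β, a < α → α < β → β < b → AbsolutelyContinuousOnInterval F α β)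
    (hd : ∀ᵐ x, x ∈ Ioo a b → HasDerivAt F (F' x) x) : HasWeakDeriv a b F F' where
  locallyIntegrableOn := hF
  locallyIntegrableOn_deriv := hF'
  byParts η hη := by
    obtain ⟨α, β, h1, h2, h3, hs⟩ := exists_Ioo_of_isCompact hab hη.2.1 hη.2.2
    have hη' : IsTest α β η := ⟨hη.1, hη.2.1, hs⟩
    have hsub : Ioo α β ⊆ Ioo a b := Ioo_subset_Ioo h1.le h3.le
    have e : ∀ g : ℝ → ℝ, (∀ x, x ∉ Ioo α β → g x = 0) →
        ∫ x in Ioo a b, g x = ∫ x in α..β, g x := fun g hg => by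
      rw [intervalIntegral.integral_of_le h2.le, integral_Ioc_eq_integral_Ioo]
      exact setIntegral_eq_of_subset_of_forall_sdiff_eq_zero measurableSet_Ioo hsub
        fun x hx => hg x hx.2
    rw [e _ fun x hx => by rw [hη'.deriv_eq_zero_of_notMem hx, mul_zero],
      e _ fun x hx => by rw [hη'.eq_zero_of_notMem hx, mul_zero],
      (hac α β h1 h2 h3).integral_mul_deriv_eq_deriv_mul
        (hη.1.of_le (by simp)).contDiffOn.absolutelyContinuousOnInterval,
      hη'.eq_zero_of_notMem (by simp : α ∉ Ioo α β), hη'.eq_zero_of_notMem (by simp : β ∉ Ioo α β)]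
    simp only [mul_zero, sub_zero, zero_sub, neg_inj]
    apply intervalIntegral.integral_congr_ae
    filter_upwards [hd] with x hx hxm
    rw [uIoc_of_le h2.le] at hxm
    rw [(hx ⟨h1.trans hxm.1, hxm.2.trans_lt h3⟩).deriv]

/-- A function whose weak derivative vanishes is constant almost everywhere. -/
theorem ae_eq_const_of_weakDeriv_zero {z : ℝ → ℝ} (hab : a < b) (hz : IntegrableOn z (Ioo a b))
    (h : ∀ η : ℝ → ℝ, IsTest a b η → ∫ x in Ioo a b, z x * deriv η x = 0) :
    ∃ k, ∀ᵐ x ∂volume.restrict (Ioo a b), z x = k := by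
  let ρ : ContDiffBump ((a + b) / 2) := ⟨(b - a) / 8, (b - a) / 4, by linarith, by linarith⟩
  set r := ρ.normed volume with hr
  have hr1 : ∫ x, r x = 1 := ρ.integral_normed
  have hrt : IsTest a b r := by
    refine ⟨ρ.contDiff_normed, ρ.hasCompactSupport_normed, ?_⟩
    rw [hr, ρ.tsupport_normed_eq, Real.closedBall_eq_Icc]
    change Icc ((a + b) / 2 - (b - a) / 4) ((a + b) / 2 + (b - a) / 4) ⊆ _
    exact Icc_subset_Ioo (by linarith) (by linarith)
  have hmul : ∀ g : ℝ → ℝ, IsTest a b g → IntegrableOn (fun x => z x * g x) (Ioo a b) := by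
    intro g hg
    obtain ⟨C, hC⟩ := hg.2.1.exists_bound_of_continuous hg.1.continuous
    exact Integrable.mul_bdd (c := C) hz hg.1.continuous.aestronglyMeasurable
      (Eventually.of_forall hC)
  set k := ∫ x in Ioo a b, z x * r x with hk
  refine ⟨k, ?_⟩
  have hzk : IntegrableOn (fun x => z x - k) (Ioo a b) := hz.sub (by simp)
  have := isOpen_Ioo.ae_eq_zero_of_integral_contDiff_smul_eq_zero (μ := volume)
    hzk.locallyIntegrableOn ?_
  · rw [ae_restrict_iff' measurableSet_Ioo]
    filter_upwards [this] with x hx hxI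
    linarith [hx hxI]
  intro g hg hgc hgs
  have hgt : IsTest a b g := ⟨hg, hgc, hgs⟩
  have hgi : Integrable g := hg.continuous.integrable_of_hasCompactSupport hgc
  have hri : Integrable r := hrt.1.continuous.integrable_of_hasCompactSupport hrt.2.1
  set c := ∫ x, g x with hc
  -- Subtracting a multiple of the unit-mass bump r gives integral zero, so the primitive of ψ has
  -- compact support and is itself an admissible test function.
  set ψ : ℝ → ℝ := fun x => g x - c * r x with hψ
  have hψi : Integrable ψ := hgi.sub (hri.const_mul c)
  have hψs : ContDiff ℝ ∞ ψ := hg.sub (contDiff_const.mul hrt.1)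
  have hψ0 : ∫ x, ψ x = 0 := by
    rw [hψ, integral_sub hgi (hri.const_mul c), integral_const_mul, hr1, ← hc]; ring
  have hderiv : ∀ x, HasDerivAt (primitive ψ) (ψ x) x := fun x =>
    hasDerivAt_primitive hψi hψs.continuous.continuousAt
  have hderiv' : deriv (primitive ψ) = ψ := funext fun x => (hderiv x).deriv
  obtain ⟨α, β, h1, h2, h3, hs⟩ := exists_Ioo_of_isCompact hab (hgc.isCompact.union hrt.2.1)
    (union_subset hgs hrt.2.2)
  have hψz : ∀ x, x ∉ Ioo α β → ψ x = 0 := fun x hx => by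
    rw [hψ]
    simp only
    rw [image_eq_zero_of_notMem_tsupport fun h' => hx (hs (Or.inl h')),
      image_eq_zero_of_notMem_tsupport (f := r) fun h' => hx (hs (Or.inr h'))]
    ring
  have hsupp : Function.support (primitive ψ) ⊆ Icc α β := by
    intro x hx
    by_contra hxn
    refine hx ?_
    rw [mem_Icc, not_and_or, not_le, not_le] at hxn
    rcases hxn with hxn | hxn
    · refine setIntegral_eq_zero_of_forall_eq_zero fun t ht => hψz t fun h' => ?_
      exact lt_asymm (mem_Iio.1 ht) (hxn.trans h'.1)
    · rw [primitive, setIntegral_eq_integral_of_forall_compl_eq_zero, hψ0]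
      intro t ht
      refine hψz t fun h' => ht (h'.2.trans hxn)
  have hcs : HasCompactSupport (primitive ψ) :=
    HasCompactSupport.of_support_subset_isCompact isCompact_Icc hsupp
  have htest : IsTest a b (primitive ψ) := by
    refine ⟨?_, hcs, ?_⟩
    · rw [contDiff_infty_iff_deriv, hderiv']
      exact ⟨fun x => (hderiv x).differentiableAt, hψs⟩
    · exact (closure_minimal hsupp isClosed_Icc).trans (Icc_subset_Ioo h1 h3)
  have key := h _ htest
  rw [hderiv'] at key
  have e1 : ∫ x in Ioo a b, z x * ψ x =
      (∫ x in Ioo a b, z x * g x) - c * k := by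
    rw [hk, ← integral_const_mul, ← integral_sub (hmul g hgt) ((hmul r hrt).const_mul c)]
    congr 1; ext x; simp only [hψ]; ring
  have e2 : c = ∫ x in Ioo a b, g x := by
    rw [setIntegral_eq_integral_of_forall_compl_eq_zero]
    exact fun x hx => hgt.eq_zero_of_notMem hx
  have e3 : ∫ x, g x • (z x - k) = ∫ x in Ioo a b, (z x * g x - k * g x) := by
    rw [← setIntegral_eq_integral_of_forall_compl_eq_zero (s := Ioo a b)]
    · congr 1; ext x; simp only [smul_eq_mul]; ring
    · intro x hx
      rw [hgt.eq_zero_of_notMem hx, zero_smul]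
  rw [e3, integral_sub (hmul g hgt) (hgi.integrableOn.const_mul k), integral_const_mul, ← e2]
  linarith

theorem hasDerivAt_div_sqrt_one_sub_sq {w : ℝ} (hw : |w| < 1) :
    HasDerivAt (fun w : ℝ => w / √(1 - w ^ 2)) (1 / √(1 - w ^ 2) ^ 3) w := by
  have h1 : 0 < 1 - w ^ 2 := by rwa [sub_pos, sq_lt_one_iff_abs_lt_one]
  have h2 : 0 < √(1 - w ^ 2) := Real.sqrt_pos.2 h1
  have h3 := (hasDerivAt_id w).div
    (((hasDerivAt_pow 2 w).const_sub 1).sqrt h1.ne') h2.ne'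
  convert! h3 using 1
  have h4 : √(1 - w ^ 2) ^ 2 = 1 - w ^ 2 := Real.sq_sqrt h1.le
  simp only [id]
  field_simp
  rw [h4]
  simp
  ring

theorem contDiffOn_div_sqrt_one_sub_sq :
    ContDiffOn ℝ 1 (fun w : ℝ => w / √(1 - w ^ 2)) {w | |w| < 1} := by
  have h1 : ∀ w ∈ {w : ℝ | |w| < 1}, 0 < 1 - w ^ 2 := fun w hw => by
    rwa [sub_pos, sq_lt_one_iff_abs_lt_one]
  refine contDiffOn_id.div (ContDiffOn.sqrt (by fun_prop) fun w hw => (h1 w hw).ne') fun w hw => ?_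
  exact (Real.sqrt_pos.2 (h1 w hw)).ne'

/-- By continuity W stays away from ±1 on compact subintervals, where the chain rule for absolutely
continuous functions applies. -/
theorem hasWeakDeriv_div_sqrt_one_sub_sq {W W' : ℝ → ℝ} (hab : a < b)
    (hW' : LocallyIntegrable W') (hac : ∀ α β, AbsolutelyContinuousOnInterval W α β)
    (hd : ∀ᵐ x, HasDerivAt W (W' x) x) (h1 : ∀ x ∈ Ioo a b, |W x| < 1) :
    HasWeakDeriv a b (fun x => W x / √(1 - W x ^ 2))
      (fun x => W' x * (1 / √(1 - W x ^ 2) ^ 3)) := by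
  have hWc : ContinuousOn W (Ioo a b) := (hac a b).continuousOn.mono <|
    Ioo_subset_Icc_self.trans Icc_subset_uIcc
  have hsq : ∀ x ∈ Ioo a b, √(1 - W x ^ 2) ≠ 0 := fun x hx => by
    have : 0 < 1 - W x ^ 2 := by rw [sub_pos, sq_lt_one_iff_abs_lt_one]; exact h1 x hx
    exact (Real.sqrt_pos.2 this).ne'
  refine hasWeakDeriv_of_absolutelyContinuous hab
    ((hWc.div (by fun_prop) hsq).locallyIntegrableOn measurableSet_Ioo) ?_ ?_ ?_
  · refine (hW'.locallyIntegrableOn _).mul_continuousOn ?_ isOpen_Ioo.isLocallyClosed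
    exact continuousOn_const.div (by fun_prop) fun x hx => pow_ne_zero _ (hsq x hx)
  · intro α β h2 h3 h4
    refine absolutelyContinuous_comp (G := fun w => w / √(1 - w ^ 2)) (hac α β)
      contDiffOn_div_sqrt_one_sub_sq fun x hx => ?_
    rw [uIcc_of_le h3.le] at hx
    exact h1 x ⟨h2.trans_le hx.1, hx.2.trans_lt h4⟩
  · filter_upwards [hd] with x hx hxI
    rw [mul_comm]
    exact (hasDerivAt_div_sqrt_one_sub_sq (h1 x hxI)).comp x hx

variable {h : ℝ → ℝ} {Du : SignedMeasure ℝ} {u : ℝ → ℝ}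

theorem regularity_of_abs_lt_one (hab : a < b) (hh : IntegrableOn h (Ioo a b))
    (hu : HasBVDeriv a b u Du) (H : FluxEquation a b h Du) {m : ℝ}
    (hm : ∀ᵐ x ∂volume.restrict (Ioo a b),
      flux (acDensity Du x) = m - primitive ((Ioo a b).indicator h) x)
    (h1 : ∀ x ∈ Ioo a b, |m - primitive ((Ioo a b).indicator h) x| < 1) :
    MemW21loc a b u ∧ MemW11 a b u ∧
      ∃ v : ℝ → ℝ, ContDiffOn ℝ 1 v (Ioo a b) ∧ u =ᵐ[volume.restrict (Ioo a b)] v := by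
  have hs := H.sing_eq_zero hab hh hu.concentrated hm h1
  have hh0 : Integrable ((Ioo a b).indicator h) := hh.integrable_indicator measurableSet_Ioo
  set W : ℝ → ℝ := fun x => m - primitive ((Ioo a b).indicator h) x with hW
  have hWc : Continuous W := continuous_const.sub (continuous_primitive hh0)
  set g : ℝ → ℝ := fun x => W x / √(1 - W x ^ 2) with hg
  have hsq : ∀ x ∈ Ioo a b, √(1 - W x ^ 2) ≠ 0 := fun x hx => by
    have : 0 < 1 - W x ^ 2 := by rw [sub_pos, sq_lt_one_iff_abs_lt_one]; exact h1 x hx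
    exact (Real.sqrt_pos.2 this).ne'
  have hgc : ContinuousOn g (Ioo a b) :=
    hWc.continuousOn.div (by fun_prop) hsq
  have hpg : ∀ᵐ x ∂volume.restrict (Ioo a b), acDensity Du x = g x := by
    filter_upwards [hm] with x hx
    rw [hg]
    simp only [hW]
    rw [← hx, flux_div]
  have hpi := integrable_acDensity Du
  have hgi : IntegrableOn g (Ioo a b) := hpi.integrableOn.congr hpg
  have hgi0 : Integrable ((Ioo a b).indicator g) := hgi.integrable_indicator measurableSet_Ioo
  have hDu : Du = volume.withDensityᵥ ((Ioo a b).indicator g) := by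
    conv_lhs => rw [← sing_add_withDensityᵥ Du, hs, zero_add]
    apply WithDensityᵥEq.congr_ae
    refine (sing_restrict_and_acDensity_indicator hu.concentrated).2.trans ?_
    rw [ae_restrict_iff' measurableSet_Ioo] at hpg
    filter_upwards [hpg] with x hx
    by_cases hxI : x ∈ Ioo a b
    · simp [hxI, hx hxI]
    · simp [hxI]
  have hwu : HasWeakDeriv a b u g := by
    refine ⟨hu.integrableOn.locallyIntegrableOn, hgi.locallyIntegrableOn, fun η hη => ?_⟩
    obtain ⟨C, hC⟩ := hη.2.1.exists_bound_of_continuous hη.1.continuous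
    rw [hu.byParts η hη, hDu, integral_withDensityᵥ hgi0 hη.1.continuous.stronglyMeasurable hC,
      ← integral_indicator measurableSet_Ioo]
    congr 2
    ext x
    by_cases hx : x ∈ Ioo a b <;> simp [hx, mul_comm]
  have hwg : HasWeakDeriv a b g (fun x => -(Ioo a b).indicator h x * (1 / √(1 - W x ^ 2) ^ 3)) := by
    refine hasWeakDeriv_div_sqrt_one_sub_sq hab hh0.neg.locallyIntegrable (fun α β => ?_) ?_ h1
    · exact (contDiffOn_const.absolutelyContinuousOnInterval (f := fun _ : ℝ => m)).sub
        (absolutelyContinuous_primitive hh0 α β)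
    · filter_upwards [ae_hasDerivAt_primitive hh0] with x hx
      exact hx.const_sub m
  refine ⟨⟨g, _, hwu, hwg⟩, ⟨hu.integrableOn, g, hgi, hwu⟩, ?_⟩
  -- The C¹ representative up to a constant: v and u share the weak derivative g, which is
  -- continuous on (a, b).
  set v := primitive ((Ioo a b).indicator g) with hv
  have hvd : ∀ x ∈ Ioo a b, HasDerivAt v (g x) x := fun x hx => by
    have h2 : (Ioo a b).indicator g =ᶠ[𝓝 x] g := by
      filter_upwards [isOpen_Ioo.mem_nhds hx] with y hy
      exact indicator_of_mem hy g
    have h3 := hasDerivAt_primitive hgi0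
      (((hgc.continuousAt (isOpen_Ioo.mem_nhds hx)).congr_of_eventuallyEq h2))
    rwa [indicator_of_mem hx] at h3
  have hvi : IntegrableOn v (Ioo a b) :=
    Measure.integrableOn_of_bounded (by simp) (continuous_primitive hgi0).aestronglyMeasurable
      (Eventually.of_forall (abs_primitive_le hgi0))
  have hwv : HasWeakDeriv a b v g :=
    hasWeakDeriv_of_absolutelyContinuous hab hvi.locallyIntegrableOn hgi.locallyIntegrableOn
      (fun α β _ _ _ => absolutelyContinuous_primitive hgi0 α β) (Eventually.of_forall hvd)
  obtain ⟨k, hk⟩ := ae_eq_const_of_weakDeriv_zero (z := fun x => u x - v x) hab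
    (hu.integrableOn.sub hvi) (fun η hη => by
      obtain ⟨C, hC⟩ := hη.2.1.deriv.exists_bound_of_continuous (hη.1.continuous_deriv (by simp))
      have hb : ∀ f : ℝ → ℝ, IntegrableOn f (Ioo a b) →
          IntegrableOn (fun x => f x * deriv η x) (Ioo a b) := fun f hf =>
        Integrable.mul_bdd (c := C) hf
          (hη.1.continuous_deriv (by simp)).aestronglyMeasurable (Eventually.of_forall hC)
      simp_rw [sub_mul]
      rw [integral_sub (hb u hu.integrableOn) (hb v hvi), hwu.byParts η hη, hwv.byParts η hη,
        sub_self])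
  refine ⟨fun x => v x + k, ?_, ?_⟩
  · have : ContDiffOn ℝ 1 v (Ioo a b) := by
      rw [contDiffOn_one_iff_derivWithin isOpen_Ioo.uniqueDiffOn]
      refine ⟨fun x hx => (hvd x hx).differentiableAt.differentiableWithinAt, ?_⟩
      exact hgc.congr fun x hx => by
        rw [derivWithin_of_isOpen isOpen_Ioo hx, (hvd x hx).deriv]
    exact this.add contDiffOn_const
  · filter_upwards [hk] with x hx
    linarith

end

/-! ### From a solution to its continuous flux -/

section

variable {a b : ℝ}

/-- All that the sign-change argument needs, free of measures. Regularity is kept as an implication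
so that the bound on |W| may be proved for W or for -W. -/
theorem IsBVSolution.exists_flux {f : ℝ → ℝ → ℝ} {u : ℝ → ℝ} (hab : a < b)
    (hu : IsBVSolution a b f u) :
    IntegrableOn (fun x => f x (u x)) (Ioo a b) ∧ ∃ W : ℝ → ℝ, Continuous W ∧
      (∀ x ∈ Icc a b, ∀ y ∈ Icc a b, W x - W y = ∫ t in x..y, f t (u t)) ∧
      (∀ᵐ x ∂volume.restrict (Ioo a b), |W x| < 1) ∧
      IntegrableOn (fun x => W x / √(1 - W x ^ 2)) (Ioo a b) ∧
      ((∀ x ∈ Ioo a b, |W x| < 1) → MemW21loc a b u ∧ MemW11 a b u ∧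
        ∃ v : ℝ → ℝ, ContDiffOn ℝ 1 v (Ioo a b) ∧ u =ᵐ[volume.restrict (Ioo a b)] v) := by
  obtain ⟨Du, hDu, hf, H⟩ := hu.exists_fluxEquation
  obtain ⟨m, hm⟩ := H.exists_flux_ae_eq hab hf
  have hf0 := hf.integrable_indicator measurableSet_Ioo
  refine ⟨hf, fun x => m - primitive ((Ioo a b).indicator fun x => f x (u x)) x,
    continuous_const.sub (continuous_primitive hf0), fun x hx y hy => ?_, ?_, ?_,
    regularity_of_abs_lt_one hab hf hDu H hm⟩
  · rw [sub_sub_sub_cancel_left, primitive_sub hf0]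
    apply intervalIntegral.integral_congr_ae
    filter_upwards [Measure.ae_ne volume a, Measure.ae_ne volume b] with t hta htb ht
    have h1 := uIcc_subset_Icc hx hy (uIoc_subset_uIcc ht)
    have h2 : t ∈ Ioo a b := ⟨lt_of_le_of_ne h1.1 hta.symm, lt_of_le_of_ne h1.2 htb⟩
    exact indicator_of_mem h2 _
  · filter_upwards [hm] with x hx
    rw [← hx]
    exact abs_flux_lt_one _
  · refine (integrable_acDensity Du).integrableOn.congr ?_
    filter_upwards [hm] with x hx
    rw [← hx, flux_div]

end

end PrescribedCurvature

end

theorem theorem3p3 (a b : ℝ) (f : ℝ → ℝ → ℝ) (u : ℝ → ℝ)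
    (hu : PrescribedCurvature.IsBVSolution a b f u) :
    -- case (h)
    ((∃ c ∈ Ioo a b,
        (∀ᵐ x ∂volume.restrict (Ioo a c), 0 ≤ f x (u x)) ∧
        (∀ᵐ x ∂volume.restrict (Ioo c b), f x (u x) ≤ 0) ∧
        ((∃ δ > 0, a ≤ c - δ ∧ ∃ μ : ℝ → ℝ, IntegrableOn μ (Ioo (c - δ) c) ∧
            (∀ᵐ x ∂volume.restrict (Ioo (c - δ) c), f x (u x) ≤ μ x) ∧
            (∀ x ∈ Ico (c - δ) c, 0 < ∫ t in x..c, μ t) ∧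
            ∫⁻ x in Ioo (c - δ) c, ENNReal.ofReal (1 / √(∫ t in x..c, μ t)) = ⊤) ∨
         (∃ δ > 0, c + δ ≤ b ∧ ∃ ν : ℝ → ℝ, IntegrableOn ν (Ioo c (c + δ)) ∧
            (∀ᵐ x ∂volume.restrict (Ioo c (c + δ)), ν x ≤ f x (u x)) ∧
            (∀ x ∈ Ioc c (c + δ), ∫ t in c..x, ν t < 0) ∧
            ∫⁻ x in Ioo c (c + δ), ENNReal.ofReal (1 / √(-∫ t in c..x, ν t)) = ⊤))) →
      PrescribedCurvature.MemW21loc a b u ∧ PrescribedCurvature.MemW11 a b u ∧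
        ∃ v : ℝ → ℝ, ContDiffOn ℝ 1 v (Ioo a b) ∧ u =ᵐ[volume.restrict (Ioo a b)] v) ∧
    -- case (hh)
    ((∃ c ∈ Ioo a b,
        (∀ᵐ x ∂volume.restrict (Ioo a c), f x (u x) ≤ 0) ∧
        (∀ᵐ x ∂volume.restrict (Ioo c b), 0 ≤ f x (u x)) ∧
        ((∃ δ > 0, a ≤ c - δ ∧ ∃ ν : ℝ → ℝ, IntegrableOn ν (Ioo (c - δ) c) ∧
            (∀ᵐ x ∂volume.restrict (Ioo (c - δ) c), ν x ≤ f x (u x)) ∧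
            (∀ x ∈ Ico (c - δ) c, ∫ t in x..c, ν t < 0) ∧
            ∫⁻ x in Ioo (c - δ) c, ENNReal.ofReal (1 / √(-∫ t in x..c, ν t)) = ⊤) ∨
         (∃ δ > 0, c + δ ≤ b ∧ ∃ μ : ℝ → ℝ, IntegrableOn μ (Ioo c (c + δ)) ∧
            (∀ᵐ x ∂volume.restrict (Ioo c (c + δ)), f x (u x) ≤ μ x) ∧
            (∀ x ∈ Ioc c (c + δ), 0 < ∫ t in c..x, μ t) ∧
            ∫⁻ x in Ioo c (c + δ), ENNReal.ofReal (1 / √(∫ t in c..x, μ t)) = ⊤))) →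
      PrescribedCurvature.MemW21loc a b u ∧ PrescribedCurvature.MemW11 a b u ∧
        ∃ v : ℝ → ℝ, ContDiffOn ℝ 1 v (Ioo a b) ∧ u =ᵐ[volume.restrict (Ioo a b)] v) := by
  constructor
  · rintro ⟨c, hc, hl, hr, hdiv⟩
    obtain ⟨hf, W, hW, hd, hW1, hint, hreg⟩ := hu.exists_flux (hc.1.trans hc.2)
    exact hreg (PrescribedCurvature.abs_lt_one_of_sign_change hc hf hW hd hW1 hint hl hr hdiv)
  · rintro ⟨c, hc, hl, hr, hdiv⟩
    obtain ⟨hf, W, hW, hd, hW1, hint, hreg⟩ := hu.exists_flux (hc.1.trans hc.2)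
    refine hreg fun x hx => ?_
    rw [← abs_neg]
    -- The map w ↦ w / √(1 - w²) is odd, so negating W and h exchanges the two cases, with -ν and -μ
    -- in the roles of μ and ν.
    refine PrescribedCurvature.abs_lt_one_of_sign_change (W := fun x => -W x)
      (h := fun x => -f x (u x)) hc hf.neg hW.neg ?_ ?_ ?_ ?_ ?_ ?_ x hx
    · intro x hx y hy
      rw [intervalIntegral.integral_neg, ← hd x hx y hy]
      ring
    · simpa only [abs_neg] using hW1
    · refine hint.neg.congr (Eventually.of_forall fun x => ?_)
      simp only [Pi.neg_apply, neg_sq, neg_div]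
    · simpa using hl
    · simpa using hr
    · rcases hdiv with ⟨δ, hδ, h1, ν, hνi, hν, hνn, hνd⟩ | ⟨δ, hδ, h1, μ, hμi, hμ, hμp, hμd⟩
      · refine Or.inl ⟨δ, hδ, h1, fun x => -ν x, hνi.neg, ?_, ?_, ?_⟩
        · simpa using hν
        · simpa using hνn
        · simpa using hνd
      · refine Or.inr ⟨δ, hδ, h1, fun x => -μ x, hμi.neg, ?_, ?_, ?_⟩
        · simpa using hμ
        · simpa using hμp
        · simpa using hμd
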